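/- Fix integers $K\ge 2$ and $n,m\ge 0$, and put $q=\max(m,n)$. In the symmetric $K$-user linear deterministic interference channel, transmitter $k$ sends $X_{k,i}\in\mathbb F_2^q$ at time $i$ (first coordinate most significant), and receiver $k$ observes $$Y_{k,i}=D^{q-n}X_{k,i}+\sum_{j\ne k}D^{q-m}X_{j,i}\qquad(\text{over }\mathbb F_2),$$ where $D$ is the $q\times q$ shift matrix that moves each bit one level down. From each receiver to its own transmitter there is a causal feedback link of $p$ bits per channel use: before time $i$ receiver $k$ feeds back a function of $Y_{k,1},\dots,Y_{k,i-1}$, and over a block of $T$ channel uses the product of the sizes of the feedback alphabets is at most $2^{pT}$. The input $X_{k,i}$ is a function of the message of user $k$ and of the feedback that transmitter $k$ has received so far, and receiver $k$ estimates its message from $Y_{k,1},\dots,Y_{k,T}$. A rate $R\ge 0$ (in bits per channel use) is an achievable symmetric rate if for every $\varepsilon>0$ and all sufficiently large $T$ there is such a scheme of block length $T$ in which every user has the same number $M\ge 2^{TR}$ of messages and, for independent uniformly distributed messages, the probability that some receiver errs is at most $\varepsilon$. The symmetric capacity is the supremum of the achievable symmetric rates. With no feedback, i.e. $p=0$, the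 symmetric capacity is $$C_{sym,0}=\begin{cases} n-m, & 0\le m\le \frac n2,\\ m, & \frac n2\le m\le \frac{2n}3,\\ n-\frac m2, & \frac{2n}3\le m<n,\\ \frac nK, & m=n,\\ \frac m2, & n<m\le 2n,\\ n, & 2n\le m.\end{cases}$$ (Where ranges overlap, the corresponding values agree.) -/

import Mathlib

open Filter

/-- A channel symbol: a vector of `q` bits, index `0` being the most significant level. -/
abbrev LevelVec (q : ℕ) : Type := Fin q → ZMod 2

/-- The `q × q` shift matrix over `𝔽₂` that moves every bit one level down. -/
def shiftMatrix (q : ℕ) : Matrix (Fin q) (Fin q) (ZMod 2) :=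
  Matrix.of fun i j => if (i : ℕ) = (j : ℕ) + 1 then 1 else 0

/-- One use of the symmetric `K`-user linear deterministic interference channel with direct gain
`n` and cross gain `m`: the signal `Y_k = D^(q-n) X_k + ∑_{j ≠ k} D^(q-m) X_j` at receiver `k`,
where `q = max m n`. -/
def received {K : ℕ} (n m : ℕ) (X : Fin K → LevelVec (max m n)) (k : Fin K) :
    LevelVec (max m n) :=
  (shiftMatrix (max m n) ^ (max m n - n)).mulVec (X k) +
    ∑ j ∈ Finset.univ.erase k, (shiftMatrix (max m n) ^ (max m n - m)).mulVec (X j)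

/-- A block code of length `T` with `M` messages per user for the `K`-user channel, with a causal
feedback link of `p` bits per channel use from each receiver to its own transmitter.

* `feedback k y` is the symbol that receiver `k` feeds back when its past outputs are the list `y`;
  at time `y.length` (counted from `0`) it lies in an alphabet of size `alphabet k y.length`, and
  over the whole block at most `2 ^ (p T)` feedback sequences are possible on each link.
* `encode k w u` is the channel input of transmitter `k` for its message `w` when the feedback
  symbols obtained so far form the list `u`.
* `decode k y` is the estimate that receiver `k` forms from its output sequence `y`. -/
structure ICCode (K q M T : ℕ) (p : ℝ) where
  feedback : Fin K → List (LevelVec q) → ℕ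
  alphabet : Fin K → ℕ → ℕ
  feedback_lt : ∀ k y, feedback k y < alphabet k y.length
  feedback_rate : ∀ k, (∏ i ∈ Finset.range T, (alphabet k i : ℝ)) ≤ (2 : ℝ) ^ (p * (T : ℝ))
  encode : Fin K → Fin M → List ℕ → LevelVec q
  decode : Fin K → List (LevelVec q) → Fin M

namespace ICCode

variable {K n m M T : ℕ} {p : ℝ}

/-- The outputs seen by each receiver in the first `i` channel uses when the messages are `w`.
In the next use, transmitter `j` knows the feedback symbols computed from all prefixes (the empty
one and the full one included) of the outputs that receiver `j` has seen so far. -/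
def outputs (C : ICCode K (max m n) M T p) (w : Fin K → Fin M) :
    ℕ → Fin K → List (LevelVec (max m n))
  | 0, _ => []
  | i + 1, k => outputs C w i k ++
      [received n m (fun j => C.encode j (w j) ((outputs C w i j).inits.map (C.feedback j))) k]

open Classical in
/-- The probability that some receiver decodes its message wrongly, for independent messages
uniformly distributed on `Fin M`. -/
noncomputable def errorProb (C : ICCode K (max m n) M T p) : ℝ :=
  ((Finset.univ.filter fun w : Fin K → Fin M =>
      ∃ k, C.decode k (C.outputs w T k) ≠ w k).card : ℝ) / (M : ℝ) ^ K

end ICCode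

/-- `R` (in bits per channel use) is an achievable symmetric rate with feedback links of capacity
`p`: for all large block lengths `T` there are codes with at least `2 ^ (T R)` messages for each
user, and with arbitrarily small error probability. -/
def AchievableSymRate (K n m : ℕ) (p R : ℝ) : Prop :=
  0 ≤ R ∧ ∀ ε : ℝ, 0 < ε → ∀ᶠ T : ℕ in atTop,
    ∃ (M : ℕ) (C : ICCode K (max m n) M T p),
      (2 : ℝ) ^ ((T : ℝ) * R) ≤ (M : ℝ) ∧ C.errorProb ≤ ε

/-- `c` is the symmetric capacity: the supremum of the achievable symmetric rates. -/
def IsSymCapacity (K n m : ℕ) (p c : ℝ) : Prop :=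
  IsLUB {R : ℝ | AchievableSymRate K n m p R} c

/-!
Feedback links of capacity `0` are useless (`ICCode.feedback_eq_zero`), so the inputs depend on
message and time only, and everything reduces to counting message tuples and to linear algebra on
the levels of the channel.

*Converse.* Fix a code with error probability at most `1 / 2`. The message tuples that are decoded
correctly make up at least half of all `M ^ K` tuples, and they are separated by the channel outputs
(`Separates`). A bound `M ^ (K - j) * 2 ^ (c * T)` on the size of a separated set gives `R ≤ c / j`
(`AchievableSymRate.le_of_card_le`). There are four such bounds, with `q = max m n`:
* a receiver hears only `n` levels of its own user, so `R ≤ n`;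
* a receiver that is given the lowest `q - m` levels of one interferer decodes that user as well, so
  `2 R ≤ 2 q - m`;
* for `m = n` every receiver decodes all messages, so `K R ≤ n`;
* for `m ≤ n`, giving each of two receivers the interference its user causes at the other one yields
  `R ≤ max m (n - m)`. The usual entropy argument is replaced by a double count
  (`card_le_of_side_information`): every correctly decoded pair is weighted by the quotient of the
  fiber sizes of the two interference maps and by its inverse, whose sum is at least `2`.

*Achievability.* All interferers use one linear code `V` over `s` channel uses. Their sum at a
receiver then lies in the image of `V` under the cross link, so `V` has zero error as soon as
`A v + B w = 0` with `v, w ∈ V` forces `v = 0`, where `A` and `B` are the direct and cross links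
(`isSymCapacity_of_parityChecks`). For `m ≤ 2 n / 3` and for `2 n ≤ m` it suffices to leave some
levels empty. In between, two channel uses are coded jointly: the levels split into chains modulo
`|n - m|`, and `IsChainCodeword` is an optimal code on a chain. For `m = n` no such `V` is nonzero,
and time sharing between the users is optimal.
-/

/-! ### The channel without feedback -/

/-- Links of capacity `0` carry nothing: the alphabets are nonempty and the product of their sizes
is at most `1`, so each of them is a singleton. -/
theorem ICCode.feedback_eq_zero {K q M T : ℕ} (C : ICCode K q M T 0) (k : Fin K)
    {y : List (LevelVec q)} (hy : y.length < T) : C.feedback k y = 0 := by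
  have hpos : ∀ i, 0 < C.alphabet k i := fun i => by
    have := C.feedback_lt k (List.replicate i 0)
    rw [List.length_replicate] at this
    omega
  have hprod : ∏ i ∈ Finset.range T, C.alphabet k i ≤ 1 := by
    have := C.feedback_rate k
    rw [zero_mul, Real.rpow_zero] at this
    exact_mod_cast this
  have hle := Nat.le_of_dvd (Finset.prod_pos fun i _ => hpos i)
    (Finset.dvd_prod_of_mem (C.alphabet k) (Finset.mem_range.2 hy))
  have := C.feedback_lt k y
  omega

/-- Without feedback, transmitter `j` sees at time `t` just the list of `t + 1` zeros. -/
theorem ICCode.outputs_eq {K n m M T : ℕ} (C : ICCode K (max m n) M T 0) (w : Fin K → Fin M) :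
    ∀ i ≤ T, ∀ k, C.outputs w i k = (List.range i).map fun t =>
      received n m (fun j => C.encode j (w j) (List.replicate (t + 1) 0)) k := by
  intro i
  induction i with
  | zero => intro _ k; simp [ICCode.outputs]
  | succ i ih =>
    intro hi k
    have hlen : ∀ j, (C.outputs w i j).length = i := fun j => by
      rw [ih (by omega) j, List.length_map, List.length_range]
    have hfb : ∀ j, (C.outputs w i j).inits.map (C.feedback j) = List.replicate (i + 1) 0 := by
      intro j
      rw [List.eq_replicate_iff]
      refine ⟨by simp [hlen], fun b hb => ?_⟩
      obtain ⟨y, hy, rfl⟩ := List.mem_map.1 hb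
      have := ((List.mem_inits _ _).1 hy).length_le
      exact C.feedback_eq_zero j (by have := hlen j; omega)
    rw [ICCode.outputs, List.range_succ, List.map_append, ← ih (by omega) k]
    simp only [hfb, List.map_cons, List.map_nil]

theorem shiftMatrix_mulVec_apply {q : ℕ} (v : LevelVec q) (i : Fin q) :
    (shiftMatrix q).mulVec v i = if 1 ≤ (i : ℕ) then v ⟨i - 1, by omega⟩ else 0 := by
  simp only [Matrix.mulVec, dotProduct, shiftMatrix, Matrix.of_apply, ite_mul, one_mul, zero_mul]
  split_ifs with h
  · rw [Finset.sum_eq_single (⟨i - 1, by omega⟩ : Fin q)]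
    · rw [if_pos (by simp only; omega)]
    · intro b _ hb
      rw [if_neg fun h' => hb (Fin.ext (by simp only; omega))]
    · simp
  · exact Finset.sum_eq_zero fun j _ => if_neg (by omega)

theorem shiftMatrix_pow_mulVec_apply {q : ℕ} (e : ℕ) (v : LevelVec q) (i : Fin q) :
    (shiftMatrix q ^ e).mulVec v i = if e ≤ (i : ℕ) then v ⟨i - e, by omega⟩ else 0 := by
  induction e generalizing v with
  | zero => simp
  | succ e ih =>
    rw [pow_succ, ← Matrix.mulVec_mulVec, ih]
    simp only [shiftMatrix_mulVec_apply]
    by_cases h : e + 1 ≤ (i : ℕ)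
    · rw [if_pos (by omega), if_pos (by omega), if_pos h]
      congr 1
    · rw [if_neg h]
      split_ifs with h1 h2
      · omega
      · rfl
      · rfl

theorem received_sub {K n m : ℕ} (X X' : Fin K → LevelVec (max m n)) (k : Fin K) :
    received n m (X - X') k = received n m X k - received n m X' k := by
  simp only [received, Pi.sub_apply, Matrix.mulVec_sub, Finset.sum_sub_distrib]
  abel

/-- If only transmitters `k` and `l` are active, receiver `k` hears a two-user channel. -/
theorem received_apply_of_pair {K n m : ℕ} {X : Fin K → LevelVec (max m n)} {k l : Fin K}
    (hkl : k ≠ l) (hX : ∀ j, j ≠ k → j ≠ l → X j = 0) :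
    received n m X k = (shiftMatrix (max m n) ^ (max m n - n)).mulVec (X k) +
      (shiftMatrix (max m n) ^ (max m n - m)).mulVec (X l) := by
  rw [received, Finset.sum_eq_single l]
  · intro j hj hjl
    rw [hX j (Finset.ne_of_mem_erase hj) hjl, Matrix.mulVec_zero]
  · simp [hkl.symm]

/-! ### Counting bounds -/

/-- The inputs `x` (user, message, time) let every receiver separate the message tuples in `G`
during the first `T` channel uses: tuples of `G` that look the same to receiver `k` have the same
`k`-th message. -/
def Separates {K M : ℕ} (n m T : ℕ) (x : Fin K → Fin M → ℕ → LevelVec (max m n))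
    (G : Finset (Fin K → Fin M)) : Prop :=
  ∀ w ∈ G, ∀ w' ∈ G, ∀ k, (∀ t < T, received n m (fun j => x j (w j) t) k =
    received n m (fun j => x j (w' j) t) k) → w k = w' k

/-- The message tuples that a code with useless feedback decodes correctly are separated. -/
theorem ICCode.exists_separates {K n m M T : ℕ} (C : ICCode K (max m n) M T 0) (hM : 0 < M)
    {ε : ℝ} (hε : C.errorProb ≤ ε) :
    ∃ x : Fin K → Fin M → ℕ → LevelVec (max m n), ∃ G : Finset (Fin K → Fin M),
      Separates n m T x G ∧ (1 - ε) * (M : ℝ) ^ K ≤ G.card := by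
  classical
  refine ⟨fun j a t => C.encode j a (List.replicate (t + 1) 0),
    Finset.univ.filter fun w => ¬ ∃ k, C.decode k (C.outputs w T k) ≠ w k, ?_, ?_⟩
  · intro w hw w' hw' k h
    simp only [Finset.mem_filter, Finset.mem_univ, true_and, not_exists, not_not] at hw hw'
    rw [← hw k, ← hw' k, C.outputs_eq w T le_rfl, C.outputs_eq w' T le_rfl]
    congr 1
    exact List.map_congr_left fun t ht => h t (List.mem_range.1 ht)
  · have hMK : (0 : ℝ) < (M : ℝ) ^ K := by positivity
    rw [ICCode.errorProb, div_le_iff₀ hMK] at hε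
    have hcard := Finset.card_filter_add_card_filter_not
      (s := (Finset.univ : Finset (Fin K → Fin M)))
      (fun w => ∃ k, C.decode k (C.outputs w T k) ≠ w k)
    rw [Finset.card_univ, Fintype.card_fun, Fintype.card_fin, Fintype.card_fin] at hcard
    have hcard' : ((Finset.univ.filter fun w : Fin K → Fin M =>
        ∃ k, C.decode k (C.outputs w T k) ≠ w k).card : ℝ) +
        ((Finset.univ.filter fun w : Fin K → Fin M =>
        ¬ ∃ k, C.decode k (C.outputs w T k) ≠ w k).card : ℝ) = (M : ℝ) ^ K := by
      exact_mod_cast hcard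
    have hε' : ((Finset.univ.filter fun w : Fin K → Fin M =>
        ∃ k, C.decode k (C.outputs w T k) ≠ w k).card : ℝ) ≤ ε * (M : ℝ) ^ K := by
      convert hε
    linarith

/-- A bound `M ^ (K - j) * 2 ^ (c * T)` on the number of separated message tuples gives the rate
bound `c / j`: at error probability `1 / 2` the separated tuples are half of all `M ^ K`. -/
theorem AchievableSymRate.le_of_card_le {K n m i j c : ℕ} (hij : i + j = K) {R : ℝ}
    (hR : AchievableSymRate K n m 0 R)
    (hG : ∀ (M T : ℕ) (x : Fin K → Fin M → ℕ → LevelVec (max m n)) (G : Finset (Fin K → Fin M)),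
      Separates n m T x G → G.card ≤ M ^ i * 2 ^ (c * T)) :
    (j : ℝ) * R ≤ c := by
  subst hij
  have key : ∀ᶠ T : ℕ in atTop, (T : ℝ) * (j * R - c) ≤ 1 := by
    filter_upwards [hR.2 (1 / 2) (by norm_num)] with T hT
    obtain ⟨M, C, hM, hC⟩ := hT
    have hM0 : (0 : ℝ) < M := lt_of_lt_of_le (by positivity) hM
    obtain ⟨x, G, hsep, hcard⟩ := C.exists_separates (by exact_mod_cast hM0) hC
    have h1 : (G.card : ℝ) ≤ (M : ℝ) ^ i * 2 ^ (c * T) := by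
      exact_mod_cast hG M T x G hsep
    have h2 : (M : ℝ) ^ j ≤ 2 * 2 ^ (c * T) := by
      rw [pow_add] at hcard
      have hMi : (0 : ℝ) < (M : ℝ) ^ i := by positivity
      refine le_of_mul_le_mul_left ?_ hMi
      linarith
    have h3 : (2 : ℝ) ^ ((T : ℝ) * R * j) ≤ 2 ^ ((1 : ℝ) + c * T) := by
      calc (2 : ℝ) ^ ((T : ℝ) * R * j) = ((2 : ℝ) ^ ((T : ℝ) * R)) ^ j := by
            rw [Real.rpow_mul (by norm_num), Real.rpow_natCast]
        _ ≤ (M : ℝ) ^ j := pow_le_pow_left₀ (by positivity) hM j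
        _ ≤ _ := h2
        _ = _ := by
            rw [Real.rpow_add (by norm_num), Real.rpow_one, ← Nat.cast_mul, Real.rpow_natCast]
    have h4 := (Real.rpow_le_rpow_left_iff (by norm_num)).1 h3
    linarith
  by_contra! hlt
  have hpos : 0 < j * R - c := by linarith
  have htend : Tendsto (fun T : ℕ => (T : ℝ) * (j * R - c)) atTop atTop :=
    tendsto_natCast_atTop_atTop.atTop_mul_const hpos
  obtain ⟨T, hT1, hT2⟩ := (key.and (htend.eventually_gt_atTop 1)).exists
  linarith

theorem card_levels (r T : ℕ) : Fintype.card (Fin T → Fin r → ZMod 2) = 2 ^ (r * T) := by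
  simp [ZMod.card, pow_mul]

/-- A single receiver hears at most `n` bits of its own user. -/
theorem Separates.card_le_direct {K M n m T : ℕ}
    {x : Fin (K + 1) → Fin M → ℕ → LevelVec (max m n)} {G : Finset (Fin (K + 1) → Fin M)}
    (h : Separates n m T x G) : G.card ≤ M ^ K * 2 ^ (n * T) := by
  have hinj : Set.InjOn (fun w : Fin (K + 1) → Fin M => ((fun j : Fin K => w j.succ),
      (fun (t : Fin T) (i : Fin n) => x 0 (w 0) t ⟨i, by omega⟩))) (G : Set _) := by
    intro w hw w' hw' heq
    obtain ⟨h1, h2⟩ := Prod.mk.inj heq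
    have hrest : ∀ j : Fin (K + 1), j ≠ 0 → w j = w' j := fun j hj => by
      obtain ⟨j, rfl⟩ := Fin.exists_succ_eq.2 hj
      exact congrFun h1 j
    have h0 : w 0 = w' 0 := by
      refine h w hw w' hw' 0 fun t ht => ?_
      simp only [received]
      congr 1
      · ext i
        rw [shiftMatrix_pow_mulVec_apply, shiftMatrix_pow_mulVec_apply]
        split_ifs with hi
        · exact congrFun (congrFun h2 ⟨t, ht⟩) ⟨i - (max m n - n), by omega⟩
        · rfl
      · exact Finset.sum_congr rfl fun j hj => by rw [hrest j (Finset.ne_of_mem_erase hj)]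
    ext j
    by_cases hj : j = 0
    · rw [hj, h0]
    · rw [hrest j hj]
  have := Finset.card_le_card_of_injOn _ (fun w _ => Finset.mem_univ _) hinj
  rwa [Finset.card_univ, Fintype.card_prod, card_levels, Fintype.card_fun, Fintype.card_fin,
    Fintype.card_fin] at this

/-- When both gains agree all receivers hear the same, so each of them decodes every message. -/
theorem Separates.card_le_of_gains_eq {K M n T : ℕ}
    {x : Fin K → Fin M → ℕ → LevelVec (max n n)} {G : Finset (Fin K → Fin M)}
    (h : Separates n n T x G) : G.card ≤ 2 ^ (n * T) := by
  have hrec : ∀ (X : Fin K → LevelVec (max n n)) k, received n n X k =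
      (shiftMatrix (max n n) ^ (max n n - n)).mulVec (∑ j, X j) := fun X k => by
    rw [received, Matrix.mulVec_sum, Finset.add_sum_erase Finset.univ (fun j =>
      (shiftMatrix (max n n) ^ (max n n - n)).mulVec (X j)) (Finset.mem_univ k)]
  have hinj : Set.InjOn (fun w : Fin K → Fin M =>
      (fun (t : Fin T) => ∑ j, x j (w j) t)) (G : Set _) := by
    intro w hw w' hw' heq
    funext k
    refine h w hw w' hw' k fun t ht => ?_
    rw [hrec, hrec]
    exact congrArg _ (congrFun heq ⟨t, ht⟩)
  have := Finset.card_le_card_of_injOn _ (fun w _ => Finset.mem_univ _) hinj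
  rwa [Finset.card_univ, card_levels, max_self] at this

/-- Receiver `0`, given the levels of user `1` below the `m`-th as a genie, decodes the messages of
both users: its own message reveals the interference, which is the upper part of user `1`'s
signal. -/
theorem Separates.card_le_genie {K M n m T : ℕ}
    {x : Fin (K + 2) → Fin M → ℕ → LevelVec (max m n)} {G : Finset (Fin (K + 2) → Fin M)}
    (h : Separates n m T x G) : G.card ≤ M ^ K * 2 ^ ((2 * max m n - m) * T) := by
  have hinj : Set.InjOn (fun w : Fin (K + 2) → Fin M => ((fun j : Fin K => w j.succ.succ),
      (fun t : Fin T => received n m (fun j => x j (w j) t) 0),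
      (fun (t : Fin T) (i : Fin (max m n - m)) => x 1 (w 1) t ⟨m + i, by omega⟩)))
      (G : Set _) := by
    intro w hw w' hw' heq
    obtain ⟨h1, h23⟩ := Prod.mk.inj heq
    obtain ⟨h2, h3⟩ := Prod.mk.inj h23
    have hrest : ∀ j : Fin (K + 2), j ≠ 0 → j ≠ 1 → w j = w' j := fun j hj hj1 => by
      obtain ⟨j, rfl⟩ := Fin.exists_succ_eq.2 hj
      obtain ⟨j, rfl⟩ := Fin.exists_succ_eq.2 (show j ≠ 0 from fun h => hj1 (by rw [h]; rfl))
      exact congrFun h1 j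
    have h0 : w 0 = w' 0 := h w hw w' hw' 0 fun t ht => congrFun h2 ⟨t, ht⟩
    have hx1 : ∀ t < T, x 1 (w 1) t = x 1 (w' 1) t := by
      intro t ht
      have hB := congrFun h2 ⟨t, ht⟩
      simp only at hB
      rw [← sub_eq_zero, ← received_sub, received_apply_of_pair (l := 1) (by simp)] at hB
      · ext i
        by_cases hi : (i : ℕ) < m
        · have := congrFun hB ⟨i + (max m n - m), by omega⟩
          simp only [Pi.add_apply, shiftMatrix_pow_mulVec_apply, Pi.sub_apply, h0, sub_self,
            ite_self, zero_add, Pi.zero_apply, le_add_iff_nonneg_left, zero_le, if_true,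
            Nat.add_sub_cancel, Fin.eta] at this
          exact sub_eq_zero.1 this
        · have := congrFun (congrFun h3 ⟨t, ht⟩) ⟨i - m, by omega⟩
          simp only [Nat.add_sub_cancel' (not_lt.1 hi)] at this
          exact this
      · intro j hj hj1
        simp [hrest j hj hj1]
    have h1' : w 1 = w' 1 := by
      refine h w hw w' hw' 1 fun t ht => ?_
      congr 1
      funext j
      by_cases hj1 : j = 1
      · rw [hj1, hx1 t ht]
      by_cases hj : j = 0
      · rw [hj, h0]
      · rw [hrest j hj hj1]
    funext j
    by_cases hj1 : j = 1
    · rw [hj1, h1']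
    by_cases hj : j = 0
    · rw [hj, h0]
    · exact hrest j hj hj1
  have := Finset.card_le_card_of_injOn _ (fun w _ => Finset.mem_univ _) hinj
  rw [Finset.card_univ, Fintype.card_prod, Fintype.card_prod, card_levels, card_levels,
    Fintype.card_fun, Fintype.card_fin, Fintype.card_fin, ← pow_add, ← add_mul] at this
  rwa [show 2 * max m n - m = max m n + (max m n - m) by omega]

/-- One half of the estimate behind `card_le_of_side_information`. For a fixed value `s` of `S`, a
value of `Y` determines `f u` and `S' (g u)`, so the elements `u` of `G` with these values differ in
`g u` only, within one fiber of `S'`. -/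
theorem sum_card_fiber_div_le {ι α β σ τ γ : Type*} [Fintype α] [Fintype β] [Fintype σ]
    [Fintype γ] [DecidableEq σ] [DecidableEq τ]
    [DecidableEq γ] (G : Finset ι) (f : ι → α) (g : ι → β)
    (hfg : ∀ u ∈ G, ∀ v ∈ G, f u = f v → g u = g v → u = v) (S : α → σ) (S' : β → τ) (Y : ι → γ)
    (h : ∀ u ∈ G, ∀ v ∈ G, S (f u) = S (f v) → Y u = Y v → f u = f v ∧ S' (g u) = S' (g v)) :
    ∑ u ∈ G, ((Finset.univ.filter fun a => S a = S (f u)).card : ℝ) /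
      (Finset.univ.filter fun b => S' b = S' (g u)).card ≤ Fintype.card γ * Fintype.card α := by
  rw [← Finset.sum_fiberwise G (fun u => (S (f u), Y u))]
  calc _ ≤ ∑ p : σ × γ, ((Finset.univ.filter fun a => S a = p.1).card : ℝ) := by
        refine Finset.sum_le_sum fun p _ => ?_
        rcases (G.filter fun u => (S (f u), Y u) = p).eq_empty_or_nonempty with he | ⟨u₀, hu₀⟩
        · rw [he, Finset.sum_empty]
          positivity
        have hmem : ∀ u ∈ G.filter (fun u => (S (f u), Y u) = p),
            u ∈ G ∧ S (f u) = p.1 ∧ f u = f u₀ ∧ S' (g u) = S' (g u₀) := by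
          intro u hu
          rw [Finset.mem_filter, Prod.ext_iff] at hu hu₀
          exact ⟨hu.1, hu.2.1, h u hu.1 u₀ hu₀.1 (hu.2.1.trans hu₀.2.1.symm)
            (hu.2.2.trans hu₀.2.2.symm)⟩
        have hcard : ((G.filter fun u => (S (f u), Y u) = p).card : ℝ) ≤
            (Finset.univ.filter fun b => S' b = S' (g u₀)).card := by
          refine Nat.cast_le.2 (Finset.card_le_card_of_injOn g (fun u hu => ?_)
            fun u hu v hv huv => ?_)
          · simpa using (hmem u hu).2.2.2
          · have hu := hmem u hu
            have hv := hmem v hv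
            exact hfg u hu.1 v hv.1 (hu.2.2.1.trans hv.2.2.1.symm) huv
        rw [Finset.sum_congr rfl fun u hu => by
          rw [(hmem u hu).2.1, (hmem u hu).2.2.2], Finset.sum_const, nsmul_eq_mul]
        have hpos : (0 : ℝ) < (Finset.univ.filter fun b => S' b = S' (g u₀)).card :=
          Nat.cast_pos.2 (Finset.card_pos.2 ⟨g u₀, by simp⟩)
        rw [mul_div_assoc', div_le_iff₀ hpos, mul_comm]
        exact mul_le_mul_of_nonneg_left hcard (Nat.cast_nonneg _)
    _ = _ := by
        rw [Fintype.sum_prod_type_right]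
        simp only [Finset.sum_const, Finset.card_univ, nsmul_eq_mul]
        rw [← Nat.cast_sum, ← Finset.card_eq_sum_card_fiberwise (fun a _ => Finset.mem_univ (S a)),
          Finset.card_univ]

/-- Counting form of the entropy inequality
`I(A; Y, S) + I(B; Y', S') ≤ H(Y | S) + H(Y' | S')` for uniform `A`, `B`, where `S` is the
interference caused by `A` and `S'` the one caused by `B`. The fiber sizes of `S` and `S'` take the
place of the entropies, and they cancel by `x / y + y / x ≥ 2`. -/
theorem card_le_of_side_information {ι α σ γ : Type*} [Fintype α] [Fintype σ]
    [Fintype γ] [DecidableEq σ] [DecidableEq γ] (G : Finset ι) (f g : ι → α)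
    (hfg : ∀ u ∈ G, ∀ v ∈ G, f u = f v → g u = g v → u = v) (S S' : α → σ) (Y Y' : ι → γ)
    (h : ∀ u ∈ G, ∀ v ∈ G, S (f u) = S (f v) → Y u = Y v → f u = f v ∧ S' (g u) = S' (g v))
    (h' : ∀ u ∈ G, ∀ v ∈ G, S' (g u) = S' (g v) → Y' u = Y' v → g u = g v ∧ S (f u) = S (f v)) :
    G.card ≤ Fintype.card γ * Fintype.card α := by
  have h1 := sum_card_fiber_div_le G f g hfg S S' Y h
  have h2 := sum_card_fiber_div_le G g f (fun u hu v hv a b => hfg u hu v hv b a) S' S Y' h'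
  have h3 : ∑ u ∈ G, (2 : ℝ) ≤ ∑ u ∈ G,
      (((Finset.univ.filter fun a => S a = S (f u)).card : ℝ) /
        (Finset.univ.filter fun b => S' b = S' (g u)).card +
      ((Finset.univ.filter fun b => S' b = S' (g u)).card : ℝ) /
        (Finset.univ.filter fun a => S a = S (f u)).card) := by
    refine Finset.sum_le_sum fun u _ => ?_
    have hx : (0 : ℝ) < (Finset.univ.filter fun a => S a = S (f u)).card :=
      Nat.cast_pos.2 (Finset.card_pos.2 ⟨f u, by simp⟩)
    have hy : (0 : ℝ) < (Finset.univ.filter fun b => S' b = S' (g u)).card :=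
      Nat.cast_pos.2 (Finset.card_pos.2 ⟨g u, by simp⟩)
    rw [div_add_div _ _ hy.ne' hx.ne', le_div_iff₀ (mul_pos hy hx)]
    nlinarith [sq_nonneg (((Finset.univ.filter fun a => S a = S (f u)).card : ℝ) -
      (Finset.univ.filter fun b => S' b = S' (g u)).card)]
  rw [Finset.sum_const, nsmul_eq_mul, Finset.sum_add_distrib] at h3
  have h4 : (G.card : ℝ) ≤ Fintype.card γ * Fintype.card α := by linarith
  exact_mod_cast h4

/-- Fix the messages of all users but `k` and `l`, and let receiver `k` know the first `m` levels of its
own user's signal. The first `e` levels it hears come from there without interference, so the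
levels from `e` on suffice for decoding; what remains is the interference from user `l`. -/
theorem Separates.eq_and_interference_eq {K M n m T e : ℕ}
    {x : Fin K → Fin M → ℕ → LevelVec (max m n)} {G : Finset (Fin K → Fin M)}
    (h : Separates n m T x G) (hem : e ≤ m) (hen : e + m ≤ n) {k l : Fin K} (hkl : k ≠ l)
    {w w' : Fin K → Fin M} (hw : w ∈ G) (hw' : w' ∈ G)
    (hrest : ∀ j, j ≠ k → j ≠ l → w j = w' j)
    (hS : ∀ t < T, ∀ i : Fin (max m n), (i : ℕ) < m → x k (w k) t i = x k (w' k) t i)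
    (hY : ∀ t < T, ∀ i : Fin (max m n), e ≤ (i : ℕ) →
      received n m (fun j => x j (w j) t) k i = received n m (fun j => x j (w' j) t) k i) :
    w k = w' k ∧
      ∀ t < T, ∀ i : Fin (max m n), (i : ℕ) < m → x l (w l) t i = x l (w' l) t i := by
  have hsub : ∀ t, received n m (fun j => x j (w j) t) k - received n m (fun j => x j (w' j) t) k =
      (shiftMatrix (max m n) ^ (max m n - n)).mulVec (x k (w k) t - x k (w' k) t) +
      (shiftMatrix (max m n) ^ (max m n - m)).mulVec (x l (w l) t - x l (w' l) t) := by
    intro t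
    rw [← received_sub, received_apply_of_pair hkl]
    · rfl
    · intro j hj hj1
      simp [hrest j hj hj1]
  have hrec : ∀ t < T,
      received n m (fun j => x j (w j) t) k = received n m (fun j => x j (w' j) t) k := by
    intro t ht
    ext i
    by_cases hi : e ≤ (i : ℕ)
    · exact hY t ht i hi
    have := congrFun (hsub t) i
    simp only [Pi.add_apply, shiftMatrix_pow_mulVec_apply, Pi.sub_apply] at this
    rw [if_pos (by omega), if_neg (by omega), add_zero, hS t ht _ (by simp only; omega),
      sub_self] at this
    exact sub_eq_zero.1 this
  have hk : w k = w' k := h w hw w' hw' k hrec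
  refine ⟨hk, fun t ht i hi => ?_⟩
  have := congrFun (hsub t) ⟨i + (max m n - m), by omega⟩
  rw [hrec t ht, hk] at this
  simp only [sub_self, Matrix.mulVec_zero, zero_add, shiftMatrix_pow_mulVec_apply,
    le_add_iff_nonneg_left, zero_le, if_true, Nat.add_sub_cancel, Fin.eta, Pi.sub_apply] at this
  exact sub_eq_zero.1 this.symm

/-- The bound for weak interference: each of the receivers `0` and `1` is given the interference
that its own user causes to the other. -/
theorem Separates.card_le_side_information {K M n m T e : ℕ}
    {x : Fin (K + 2) → Fin M → ℕ → LevelVec (max m n)} {G : Finset (Fin (K + 2) → Fin M)}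
    (h : Separates n m T x G) (hem : e ≤ m) (hen : e + m ≤ n) :
    G.card ≤ M ^ (K + 1) * 2 ^ ((n - e) * T) := by
  classical
  have hfib : ∀ ρ : Fin K → Fin M, (G.filter fun w => (fun j : Fin K => w j.succ.succ) = ρ).card ≤
      2 ^ ((n - e) * T) * M := by
    intro ρ
    have hrest : ∀ u ∈ G.filter (fun w => (fun j : Fin K => w j.succ.succ) = ρ),
        ∀ v ∈ G.filter (fun w => (fun j : Fin K => w j.succ.succ) = ρ),
        ∀ j, j ≠ 0 → j ≠ 1 → u j = v j := by
      intro u hu v hv j hj hj1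
      obtain ⟨j, rfl⟩ := Fin.exists_succ_eq.2 hj
      obtain ⟨j, rfl⟩ := Fin.exists_succ_eq.2 (show j ≠ 0 from fun h => hj1 (by rw [h]; rfl))
      exact congrFun ((Finset.mem_filter.1 hu).2.trans (Finset.mem_filter.1 hv).2.symm) j
    have upper : ∀ {j : Fin (K + 2)} {a b : Fin M},
        (fun (t : Fin T) (i : Fin m) => x j a t ⟨i, by omega⟩) =
          (fun (t : Fin T) (i : Fin m) => x j b t ⟨i, by omega⟩) ↔
        ∀ t < T, ∀ i : Fin (max m n), (i : ℕ) < m → x j a t i = x j b t i := fun {j a b} =>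
      ⟨fun hab t ht i hi => congrFun (congrFun hab ⟨t, ht⟩) ⟨i, hi⟩,
        fun hab => by ext t i; exact hab t t.2 _ i.2⟩
    have lower : ∀ {k : Fin (K + 2)} {u v : Fin (K + 2) → Fin M},
        (fun (t : Fin T) (i : Fin (n - e)) =>
          received n m (fun j => x j (u j) t) k ⟨e + i, by omega⟩) =
          (fun (t : Fin T) (i : Fin (n - e)) =>
          received n m (fun j => x j (v j) t) k ⟨e + i, by omega⟩) →
        ∀ t < T, ∀ i : Fin (max m n), e ≤ (i : ℕ) →
      received n m (fun j => x j (u j) t) k i = received n m (fun j => x j (v j) t) k i := by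
      intro k u v huv t ht i hi
      have := congrFun (congrFun huv ⟨t, ht⟩) ⟨i - e, by omega⟩
      simp only [Nat.add_sub_cancel' hi] at this
      exact this
    have := card_le_of_side_information
      (G.filter fun w => (fun j : Fin K => w j.succ.succ) = ρ) (fun w => w 0) (fun w => w 1)
      (fun u hu v hv h0 h1 => by
        funext j
        by_cases hj : j = 0
        · rw [hj]; exact h0
        by_cases hj1 : j = 1
        · rw [hj1]; exact h1
        · exact hrest u hu v hv j hj hj1)
      (fun a (t : Fin T) (i : Fin m) => x 0 a t ⟨i, by omega⟩)
      (fun a (t : Fin T) (i : Fin m) => x 1 a t ⟨i, by omega⟩)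
      (fun w (t : Fin T) (i : Fin (n - e)) =>
        received n m (fun j => x j (w j) t) 0 ⟨e + i, by omega⟩)
      (fun w (t : Fin T) (i : Fin (n - e)) =>
        received n m (fun j => x j (w j) t) 1 ⟨e + i, by omega⟩)
      (fun u hu v hv hS hY => by
        obtain ⟨h1, h2⟩ := h.eq_and_interference_eq hem hen (k := 0) (l := 1) (by simp)
          (Finset.mem_filter.1 hu).1 (Finset.mem_filter.1 hv).1 (hrest u hu v hv)
          (upper.1 hS) (lower hY)
        exact ⟨h1, upper.2 h2⟩)
      (fun u hu v hv hS hY => by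
        obtain ⟨h1, h2⟩ := h.eq_and_interference_eq hem hen (k := 1) (l := 0) (by simp)
          (Finset.mem_filter.1 hu).1 (Finset.mem_filter.1 hv).1
          (fun j hj hj1 => hrest u hu v hv j hj1 hj) (upper.1 hS) (lower hY)
        exact ⟨h1, upper.2 h2⟩)
    rwa [card_levels, Fintype.card_fin] at this
  have := Finset.card_le_mul_card_image_of_maps_to (s := G) (t := Finset.univ)
    (f := fun w => fun j : Fin K => w j.succ.succ) (fun _ _ => Finset.mem_univ _) _
    (fun ρ _ => hfib ρ)
  rw [Finset.card_univ, Fintype.card_fun, Fintype.card_fin, Fintype.card_fin] at this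
  calc _ ≤ _ := this
    _ = _ := by ring

/-! ### Zero-error block codes -/

/-- Inputs that separate all message tuples form a code without errors. -/
theorem Separates.exists_code {K n m M T : ℕ} (hM : 0 < M)
    {x : Fin K → Fin M → ℕ → LevelVec (max m n)} (h : Separates n m T x Finset.univ) :
    ∃ C : ICCode K (max m n) M T 0, C.errorProb = 0 := by
  classical
  let out : (Fin K → Fin M) → Fin K → List (LevelVec (max m n)) := fun w k =>
    (List.range T).map fun t => received n m (fun j => x j (w j) t) k
  let C : ICCode K (max m n) M T 0 :=
    { feedback := fun _ _ => 0
      alphabet := fun _ _ => 1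
      feedback_lt := fun _ _ => one_pos
      feedback_rate := fun _ => by simp
      encode := fun k a u => x k a (u.length - 1)
      decode := fun k y => if hy : ∃ w, out w k = y then hy.choose k else ⟨0, hM⟩ }
  have hout : ∀ w k, C.outputs w T k = out w k := fun w k => by
    rw [C.outputs_eq w T le_rfl]
    simp [C, out]
  have hdec : ∀ w k, C.decode k (C.outputs w T k) = w k := by
    intro w k
    have hy : ∃ w', out w' k = out w k := ⟨w, rfl⟩
    rw [hout]
    simp only [C]
    rw [dif_pos hy]
    refine h _ (Finset.mem_univ _) _ (Finset.mem_univ _) k fun t ht => ?_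
    exact List.map_inj_left.1 hy.choose_spec t (List.mem_range.2 ht)
  refine ⟨C, ?_⟩
  rw [ICCode.errorProb, Finset.filter_false_of_mem]
  · simp
  · rintro w - ⟨k, hk⟩
    exact hk (hdec w k)

/-- A zero-error code with message set `α` that uses the channel `s` times. -/
def IsZeroErrorCode {K s : ℕ} {α : Type*} (n m : ℕ)
    (f : Fin K → α → Fin s → LevelVec (max m n)) : Prop :=
  ∀ (k : Fin K) (w w' : Fin K → α), (∀ t, received n m (fun j => f j (w j) t) k =
    received n m (fun j => f j (w' j) t) k) → w k = w' k

/-- Repeating a zero-error code as often as it fits into the block. -/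
theorem IsZeroErrorCode.exists_separates {K n m s : ℕ} (hs : 0 < s) {α : Type*} [Fintype α]
    {f : Fin K → α → Fin s → LevelVec (max m n)} (hf : IsZeroErrorCode n m f) (T : ℕ) :
    ∃ x : Fin K → Fin (Fintype.card α ^ (T / s)) → ℕ → LevelVec (max m n),
      Separates n m T x Finset.univ := by
  let e : Fin (Fintype.card α ^ (T / s)) ≃ (Fin (T / s) → α) :=
    finFunctionFinEquiv.symm.trans (Equiv.arrowCongr (Equiv.refl _) (Fintype.equivFin α).symm)
  refine ⟨fun k a t => if h : t / s < T / s then f k (e a ⟨t / s, h⟩) ⟨t % s, Nat.mod_lt _ hs⟩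
    else 0, fun w _ w' _ k h => e.injective (funext fun b => ?_)⟩
  refine hf k (fun j => e (w j) b) (fun j => e (w' j) b) fun t => ?_
  have hdiv : (s * b + t) / s = b := by
    rw [Nat.mul_add_div hs, Nat.div_eq_of_lt t.2, add_zero]
  have hmod : (s * b + t) % s = t := by
    rw [Nat.mul_add_mod, Nat.mod_eq_of_lt t.2]
  have hlt : s * b + t < T :=
    calc s * b + t < s * (b + 1) := by rw [mul_add_one]; exact Nat.add_lt_add_left t.2 _
      _ ≤ s * (T / s) := Nat.mul_le_mul_left _ b.2
      _ ≤ T := Nat.mul_div_le T s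
  have := h (s * b + t) hlt
  simpa only [hdiv, hmod, b.2, dif_pos, Fin.eta] using this

theorem IsZeroErrorCode.achievable {K n m s c : ℕ} (hs : 0 < s) {α : Type*} [Fintype α]
    (hc : 2 ^ c ≤ Fintype.card α) {f : Fin K → α → Fin s → LevelVec (max m n)}
    (hf : IsZeroErrorCode n m f) {R : ℝ} (hR0 : 0 ≤ R) (hR : R = 0 ∨ s * R < c) :
    AchievableSymRate K n m 0 R := by
  refine ⟨hR0, fun ε hε => ?_⟩
  have hT : ∀ᶠ T : ℕ in atTop, (T : ℝ) * R ≤ (c * (T / s : ℕ) : ℕ) := by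
    rcases hR with rfl | hR
    · exact Eventually.of_forall fun T => by rw [mul_zero]; positivity
    have hpos : 0 < c - s * R := by linarith
    have htend : Tendsto (fun T : ℕ => (T : ℝ) * (c - s * R)) atTop atTop :=
      tendsto_natCast_atTop_atTop.atTop_mul_const hpos
    filter_upwards [htend.eventually_ge_atTop (c * s)] with T hT
    have h1 : (T : ℝ) ≤ s * ((T / s : ℕ) : ℝ) + s := by
      have : T ≤ s * (T / s) + s := by
        have := Nat.div_add_mod T s
        have := Nat.mod_lt T hs
        omega
      exact_mod_cast this
    have hs' : (0 : ℝ) < s := Nat.cast_pos.2 hs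
    rw [Nat.cast_mul]
    refine le_of_mul_le_mul_left ?_ hs'
    nlinarith [mul_le_mul_of_nonneg_left h1 (Nat.cast_nonneg (α := ℝ) c)]
  filter_upwards [hT] with T hT
  have hcard : 0 < Fintype.card α := lt_of_lt_of_le (by positivity) hc
  obtain ⟨x, hx⟩ := hf.exists_separates hs T
  obtain ⟨C, hC⟩ := hx.exists_code (pow_pos hcard _)
  refine ⟨_, C, ?_, hC.trans_le hε.le⟩
  calc (2 : ℝ) ^ ((T : ℝ) * R) ≤ 2 ^ ((c * (T / s : ℕ) : ℕ) : ℝ) :=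
        Real.rpow_le_rpow_of_exponent_le (by norm_num) hT
    _ = ((2 ^ c : ℕ) : ℝ) ^ (T / s) := by
        rw [Real.rpow_natCast, pow_mul, Nat.cast_pow, Nat.cast_ofNat]
    _ ≤ (Fintype.card α : ℝ) ^ (T / s) :=
        pow_le_pow_left₀ (Nat.cast_nonneg _) (Nat.cast_le.2 hc) _
    _ = _ := by rw [Nat.cast_pow]

/-- The lower bound `c / s` from a zero-error code and a matching upper bound. The rate `0` is always
achievable, so the supremum is not taken over the empty set. -/
theorem IsZeroErrorCode.isSymCapacity {K n m s c : ℕ} (hs : 0 < s) {α : Type*} [Fintype α]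
    (hc : 2 ^ c ≤ Fintype.card α) {f : Fin K → α → Fin s → LevelVec (max m n)}
    (hf : IsZeroErrorCode n m f)
    (hub : ∀ R, AchievableSymRate K n m 0 R → s * R ≤ c) : IsSymCapacity K n m 0 (c / s) := by
  have hs' : (0 : ℝ) < s := Nat.cast_pos.2 hs
  refine ⟨fun R hR => ?_, fun B hB => ?_⟩
  · rw [le_div_iff₀ hs', mul_comm]
    exact hub R hR
  · have hB0 : 0 ≤ B := hB (hf.achievable hs hc le_rfl (Or.inl rfl))
    by_contra! hlt
    obtain ⟨R, hBR, hR⟩ := exists_between hlt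
    rw [lt_div_iff₀ hs', mul_comm] at hR
    exact hBR.not_ge (hB (hf.achievable hs hc (hB0.trans hBR.le) (Or.inr hR)))

/-- A linear code, the same for all users, given by parity checks `φ`. All interference lies in the
image of the code under the cross link, however many users there are, so separating signal and
interference is a two-user condition. -/
theorem isSymCapacity_of_parityChecks {K n m s r c : ℕ} (hs : 0 < s)
    (hc : r + c = s * max m n) (φ : (Fin s → LevelVec (max m n)) →ₗ[ZMod 2] (Fin r → ZMod 2))
    (hφ : ∀ v w : Fin s → LevelVec (max m n), φ v = 0 → φ w = 0 →
      (∀ t, (shiftMatrix (max m n) ^ (max m n - n)).mulVec (v t) +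
        (shiftMatrix (max m n) ^ (max m n - m)).mulVec (w t) = 0) → v = 0)
    (hub : ∀ R, AchievableSymRate K n m 0 R → s * R ≤ c) : IsSymCapacity K n m 0 (c / s) := by
  classical
  have hcard : 2 ^ c ≤ Fintype.card (LinearMap.ker φ) := by
    rw [← Nat.card_eq_fintype_card, Module.natCard_eq_pow_finrank (K := ZMod 2), Nat.card_zmod]
    refine Nat.pow_le_pow_right two_pos ?_
    have h1 := φ.finrank_range_add_finrank_ker
    have h2 := Submodule.finrank_le (LinearMap.range φ)
    rw [Module.finrank_fin_fun] at h2
    rw [Module.finrank_pi_fintype] at h1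
    simp only [Module.finrank_fin_fun, Finset.sum_const, Finset.card_univ, Fintype.card_fin,
      smul_eq_mul] at h1
    omega
  refine IsZeroErrorCode.isSymCapacity hs hcard (f := fun _ v t => (v : Fin s → _) t) ?_ hub
  intro k w w' h
  have := hφ (w k - w' k) (∑ j ∈ Finset.univ.erase k, (w j - w' j : LinearMap.ker φ)) ?_ ?_ ?_
  · exact Subtype.ext (sub_eq_zero.1 this)
  · exact LinearMap.mem_ker.1 (w k - w' k).2
  · exact LinearMap.mem_ker.1 (Submodule.sum_mem _ fun j _ => (w j - w' j).2)
  · intro t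
    have h0 := h t
    rw [← sub_eq_zero, ← received_sub, received] at h0
    rw [← h0]
    simp [Matrix.mulVec_sum, Finset.sum_apply, Matrix.mulVec_sub]

/-! ### Linear codes given by parity checks on the levels -/

/-- The functional reading the bit on level `i` in channel use `a`; it is `0` if there is no such
level. -/
def level {q s : ℕ} (a : Fin s) (i : ℕ) : (Fin s → LevelVec q) →ₗ[ZMod 2] ZMod 2 :=
  if h : i < q then (LinearMap.proj ⟨i, h⟩ : LevelVec q →ₗ[ZMod 2] ZMod 2) ∘ₗ LinearMap.proj a
  else 0

theorem level_apply {q s : ℕ} (a : Fin s) (v : Fin s → LevelVec q) (i : Fin q) :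
    level a (i : ℕ) v = v a i := by
  simp [level]

theorem level_mulVec {q s e : ℕ} (a : Fin s) (v : Fin s → LevelVec q) (i : Fin q) :
    (shiftMatrix q ^ e).mulVec (v a) i = if e ≤ (i : ℕ) then level a (i - e) v else 0 := by
  rw [shiftMatrix_pow_mulVec_apply]
  split_ifs
  · exact (level_apply a v ⟨i - e, by omega⟩).symm
  · rfl

/-- `isSymCapacity_of_parityChecks` written out level by level. -/
theorem isSymCapacity_of_levelChecks {K n m s r c : ℕ} (hs : 0 < s) (hc : r + c = s * max m n)
    (φ : ℕ → (Fin s → LevelVec (max m n)) →ₗ[ZMod 2] ZMod 2)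
    (hφ : ∀ v w : Fin s → LevelVec (max m n), (∀ τ < r, φ τ v = 0) → (∀ τ < r, φ τ w = 0) →
      (∀ a, ∀ i < max m n,
        (if max m n - n ≤ i then level a (i - (max m n - n)) v else 0) +
        (if max m n - m ≤ i then level a (i - (max m n - m)) w else 0) = 0) →
      ∀ a, ∀ i < max m n, level a i v = 0)
    (hub : ∀ R, AchievableSymRate K n m 0 R → s * R ≤ c) : IsSymCapacity K n m 0 (c / s) := by
  refine isSymCapacity_of_parityChecks hs hc (LinearMap.pi fun τ : Fin r => φ τ) ?_ hub
  intro v w hv hw h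
  funext a i
  rw [← level_apply a v i]
  refine hφ v w (fun τ hτ => congrFun hv ⟨τ, hτ⟩) (fun τ hτ => congrFun hw ⟨τ, hτ⟩) ?_ a i i.2
  intro a i hi
  have := congrFun (h a) ⟨i, hi⟩
  rwa [Pi.add_apply, level_mulVec, level_mulVec] at this

/-! ### A two-slot code on a chain of levels -/

/-- A code of dimension `N + 2` (on levels `0, …, N`) or `N` (on levels `0, …, N - 1`) for two
channel uses with bits `E i`, `F i` on level `i`, when the interference is shifted by one level
relative to the signal. For even `N` every other level stays empty. For odd `N` this would lose one
dimension; it is recovered by a bit sent twice, on level `1` of the first and on level `2` of the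
second channel use. -/
def IsChainCodeword (N : ℕ) (E F : ℕ → ZMod 2) : Prop :=
  if Even N then ∀ p < N, Odd p → E p = 0 ∧ F p = 0
  else F 1 = 0 ∧ E 2 = 0 ∧ F 2 = E 1 ∧ ∀ p < N, Even p → 4 ≤ p → E p = 0 ∧ F p = 0

/-- A codeword on levels `0, …, N` can be told from interference one level further down. -/
theorem IsChainCodeword.eq_zero_of_interference_below {N : ℕ} (hN : 2 ≤ N) {E F E' F' : ℕ → ZMod 2}
    (h : IsChainCodeword N E F) (h' : IsChainCodeword N E' F') (hE0 : E 0 = 0) (hF0 : F 0 = 0)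
    (hE : ∀ i < N, E (i + 1) + E' i = 0) (hF : ∀ i < N, F (i + 1) + F' i = 0) :
    ∀ i ≤ N, E i = 0 ∧ F i = 0 := by
  unfold IsChainCodeword at h h'
  intro i hi
  split_ifs at h h' with hpar
  · rcases i with _ | i
    · exact ⟨hE0, hF0⟩
    rcases Nat.even_or_odd i with hi' | hi'
    · refine h (i + 1) (lt_of_le_of_ne hi fun heq => ?_) hi'.add_one
      rw [← heq] at hpar
      exact Nat.not_even_iff_odd.2 hi'.add_one hpar
    · have h1 := hE i (by omega)
      have h2 := hF i (by omega)
      rw [(h' i (by omega) hi').1, add_zero] at h1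
      rw [(h' i (by omega) hi').2, add_zero] at h2
      exact ⟨h1, h2⟩
  · have hN3 : 3 ≤ N := by
      rcases hN.eq_or_lt with rfl | h3
      · exact absurd even_two hpar
      · exact h3
    obtain ⟨hF1, hE2, hF2, hrest⟩ := h
    obtain ⟨hF1', hE2', hF2', hrest'⟩ := h'
    have hF2z : F 2 = 0 := by simpa [hF1'] using hF 1 (by omega)
    have hE1' : E' 1 = 0 := by simpa [hE2] using hE 1 (by omega)
    match i with
    | 0 => exact ⟨hE0, hF0⟩
    | 1 => exact ⟨by rw [← hF2, hF2z], hF1⟩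
    | 2 => exact ⟨hE2, hF2z⟩
    | 3 => exact ⟨by simpa [hE2'] using hE 2 (by omega),
        by simpa [hF2', hE1'] using hF 2 (by omega)⟩
    | i + 4 =>
      rcases Nat.even_or_odd i with hi' | hi'
      · have hev : Even (i + 4) := hi'.add (by decide)
        refine hrest (i + 4) (lt_of_le_of_ne hi fun heq => ?_) hev (by omega)
        exact hpar (heq ▸ hev)
      · have hev : Even (i + 3) := hi'.add_odd (by decide)
        have h1 := hE (i + 3) (by omega)
        have h2 := hF (i + 3) (by omega)
        obtain ⟨h3, h4⟩ := hrest' (i + 3) (by omega) hev (by have := hi'.pos; omega)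
        rw [h3, add_zero] at h1
        rw [h4, add_zero] at h2
        exact ⟨h1, h2⟩

/-- A codeword on levels `0, …, N - 1` can be told from interference one level further up. -/
theorem IsChainCodeword.eq_zero_of_interference_above {N : ℕ} (hN : 2 ≤ N) {E F E' F' : ℕ → ZMod 2}
    (h : IsChainCodeword N E F) (h' : IsChainCodeword N E' F')
    (hE : ∀ i, i + 1 < N → E i + E' (i + 1) = 0) (hF : ∀ i, i + 1 < N → F i + F' (i + 1) = 0) :
    ∀ i < N, E i = 0 ∧ F i = 0 := by
  unfold IsChainCodeword at h h'
  intro i hi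
  split_ifs at h h' with hpar
  · rcases Nat.even_or_odd i with hi' | hi'
    · have hlt : i + 1 < N := lt_of_le_of_ne hi fun heq => by
        rw [← heq] at hpar
        exact Nat.not_even_iff_odd.2 hi'.add_one hpar
      have h1 := hE i hlt
      have h2 := hF i hlt
      rw [(h' _ hlt hi'.add_one).1, add_zero] at h1
      rw [(h' _ hlt hi'.add_one).2, add_zero] at h2
      exact ⟨h1, h2⟩
    · exact h i hi hi'
  · have hN3 : 3 ≤ N := by
      rcases hN.eq_or_lt with rfl | h3
      · exact absurd even_two hpar
      · exact h3
    obtain ⟨hF1, hE2, hF2, hrest⟩ := h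
    obtain ⟨hF1', hE2', hF2', hrest'⟩ := h'
    have hE1 : E 1 = 0 := by simpa [hE2'] using hE 1 (by omega)
    have hF2' : F' 2 = 0 := by simpa [hF1] using hF 1 (by omega)
    match i with
    | 0 => exact ⟨by simpa [← ‹F' 2 = E' 1›, hF2'] using hE 0 (by omega),
        by simpa [hF1'] using hF 0 (by omega)⟩
    | 1 => exact ⟨hE1, hF1⟩
    | 2 => exact ⟨hE2, hF2.trans hE1⟩
    | i + 3 =>
      rcases Nat.even_or_odd i with hi' | hi'
      · have hev : Even (i + 4) := hi'.add (by decide)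
        have hlt : i + 4 < N := by
          have hodd := Nat.not_even_iff_odd.1 hpar
          obtain ⟨a, ha⟩ := hi'
          obtain ⟨b, hb⟩ := hodd
          omega
        have h1 := hE (i + 3) hlt
        have h2 := hF (i + 3) hlt
        obtain ⟨h3, h4⟩ := hrest' (i + 4) hlt hev (by omega)
        rw [h3, add_zero] at h1
        rw [h4, add_zero] at h2
        exact ⟨h1, h2⟩
      · exact hrest (i + 3) hi (hi'.add_odd (by decide)) (by have := hi'.pos; omega)

/-- The parity checks of `IsChainCodeword` on every residue class of levels modulo `d`. There are
`N = (m - 1 - r) / d + 1` numbers `τ < m` in the class of `r`, one for each of the `N` checks. -/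
def chainCheck {q : ℕ} (d m τ : ℕ) : (Fin 2 → LevelVec q) →ₗ[ZMod 2] ZMod 2 :=
  if Even ((m - 1 - τ % d) / d + 1) then
    if Even (τ / d) then level 0 (τ % d + d * (τ / d + 1)) else level 1 (τ % d + d * (τ / d))
  else if τ / d = 0 then level 1 (τ % d + d * 1)
  else if τ / d = 1 then level 0 (τ % d + d * 2)
  else if τ / d = 2 then level 1 (τ % d + d * 2) - level 0 (τ % d + d * 1)
  else if Even (τ / d) then level 1 (τ % d + d * (τ / d))
  else level 0 (τ % d + d * (τ / d + 1))

theorem isChainCodeword_of_chainCheck {q d m : ℕ} (hdm : 2 * d ≤ m)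
    {v : Fin 2 → LevelVec q} (hv : ∀ τ < m, chainCheck d m τ v = 0) {r : ℕ} (hr : r < d) :
    IsChainCodeword ((m - 1 - r) / d + 1) (fun p => level 0 (r + d * p) v)
      (fun p => level 1 (r + d * p) v) := by
  have hd : 0 < d := by omega
  have hdiv : ∀ p, (r + d * p) / d = p := fun p => by
    rw [Nat.add_mul_div_left _ _ hd, Nat.div_eq_of_lt hr, zero_add]
  have hmod : ∀ p, (r + d * p) % d = r := fun p => by
    rw [Nat.add_mul_mod_self_left, Nat.mod_eq_of_lt hr]
  have hcheck : ∀ p < (m - 1 - r) / d + 1, chainCheck d m (r + d * p) v = 0 := fun p hp => by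
    have := Nat.mul_le_mul_left d (Nat.lt_succ_iff.1 hp)
    have := Nat.mul_div_le (m - 1 - r) d
    exact hv _ (by omega)
  have hN : 1 ≤ (m - 1 - r) / d := (Nat.one_le_div_iff hd).2 (by omega)
  unfold IsChainCodeword
  unfold chainCheck at hcheck
  simp only [hdiv, hmod] at hcheck
  split_ifs with hpar
  · simp only [hpar, if_true] at hcheck
    intro p hp hodd
    obtain ⟨k, rfl⟩ := hodd
    have h1 := hcheck (2 * k) (by omega)
    have h2 := hcheck (2 * k + 1) hp
    rw [if_pos (even_two_mul k)] at h1
    rw [if_neg (Nat.not_even_iff_odd.2 (odd_two_mul_add_one k))] at h2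
    exact ⟨h1, h2⟩
  · simp only [hpar, if_false] at hcheck
    have hN3 : 2 ≤ (m - 1 - r) / d := by
      rcases hN.eq_or_lt with h1 | h1
      · rw [← h1] at hpar
        exact absurd even_two hpar
      · exact h1
    refine ⟨by simpa using hcheck 0 (by omega), by simpa using hcheck 1 (by omega),
      sub_eq_zero.1 (by simpa using hcheck 2 (by omega)), fun p hp hev h4 => ?_⟩
    obtain ⟨k, rfl⟩ := hev
    have hev : Even (k + k) := ⟨k, rfl⟩
    have h1 := hcheck (k + k) hp
    rw [if_neg (by omega), if_neg (by omega), if_neg (by omega), if_pos hev] at h1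
    have h2 := hcheck (k + k - 1) (by omega)
    rw [if_neg (by omega), if_neg (by omega), if_neg (by omega),
      if_neg (by rw [Nat.not_even_iff_odd]; exact Nat.Even.sub_odd (by omega) hev odd_one),
      Nat.sub_add_cancel (by omega)] at h2
    exact ⟨h2, h1⟩

/-- The case `m < n`: the signal arrives unshifted and the interference `n - m` levels below it. -/
theorem eq_zero_of_chainCheck_of_lt {n m : ℕ} (hmn : m < n) (h3 : 2 * n ≤ 3 * m)
    {v w : Fin 2 → LevelVec (max m n)} (hv : ∀ τ < m, chainCheck (n - m) m τ v = 0)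
    (hw : ∀ τ < m, chainCheck (n - m) m τ w = 0)
    (h : ∀ a, ∀ i < max m n,
        (if max m n - n ≤ i then level a (i - (max m n - n)) v else 0) +
        (if max m n - m ≤ i then level a (i - (max m n - m)) w else 0) = 0)
    (a : Fin 2) (i : ℕ) (hi : i < max m n) : level a i v = 0 := by
  have hmax : max m n = n := by omega
  obtain ⟨d, rfl⟩ : ∃ d, n = m + d := ⟨n - m, by omega⟩
  rw [Nat.add_sub_cancel_left] at hv hw
  have hd : 0 < d := by omega
  have h0 : ∀ a, ∀ i < d, level a i v = 0 := fun a i hi => by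
    have := h a i (by omega)
    rwa [if_pos (by omega), if_neg (by omega), add_zero,
      show i - (max m (m + d) - (m + d)) = i by omega] at this
  have h1 : ∀ a, ∀ i < m, level a (i + d) v + level a i w = 0 := fun a i hi => by
    have := h a (i + d) (by omega)
    rwa [if_pos (by omega), if_pos (by omega), show i + d - (max m (m + d) - (m + d)) = i + d by
      omega, show i + d - (max m (m + d) - m) = i by omega] at this
  have hr := Nat.mod_lt i hd
  have hdm : 2 * d ≤ m := by omega
  have hstep : ∀ p, i % d + d * p + d = i % d + d * (p + 1) := fun p => by ring
  have hlt : ∀ p < (m - 1 - i % d) / d + 1, i % d + d * p < m := fun p hp => by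
    have := Nat.mul_le_mul_left d (Nat.lt_succ_iff.1 hp)
    have := Nat.mul_div_le (m - 1 - i % d) d
    omega
  have key := (isChainCodeword_of_chainCheck hdm hv hr).eq_zero_of_interference_below
    (Nat.succ_le_succ ((Nat.one_le_div_iff hd).2 (by omega)))
    (isChainCodeword_of_chainCheck hdm hw hr) (h0 0 _ (by simpa using hr))
    (h0 1 _ (by simpa using hr))
    (fun p hp => hstep p ▸ h1 0 _ (hlt p hp)) (fun p hp => hstep p ▸ h1 1 _ (hlt p hp)) (i / d) (by
      rw [Nat.succ_eq_add_one, ← Nat.sub_le_iff_le_add, Nat.le_div_iff_mul_le hd, Nat.sub_mul, one_mul]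
      have := Nat.div_add_mod' i d
      omega)
  simp only [Nat.mod_add_div] at key
  match a with
  | 0 => exact key.1
  | 1 => exact key.2

/-- The case `n < m`: the signal arrives `m - n` levels below the unshifted interference. -/
theorem eq_zero_of_chainCheck_of_gt {n m : ℕ} (hmn : n < m) (h2 : m ≤ 2 * n)
    {v w : Fin 2 → LevelVec (max m n)} (hv : ∀ τ < m, chainCheck (m - n) m τ v = 0)
    (hw : ∀ τ < m, chainCheck (m - n) m τ w = 0)
    (h : ∀ a, ∀ i < max m n,
        (if max m n - n ≤ i then level a (i - (max m n - n)) v else 0) +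
        (if max m n - m ≤ i then level a (i - (max m n - m)) w else 0) = 0)
    (a : Fin 2) (i : ℕ) (hi : i < max m n) : level a i v = 0 := by
  have hmax : max m n = m := by omega
  obtain ⟨d, rfl⟩ : ∃ d, m = n + d := ⟨m - n, by omega⟩
  rw [Nat.add_sub_cancel_left] at hv hw
  have hd : 0 < d := by omega
  have h1 : ∀ a, ∀ i < n, level a i v + level a (i + d) w = 0 := fun a i hi => by
    have := h a (i + d) (by omega)
    rwa [if_pos (by omega), if_pos (by omega), show i + d - (max (n + d) n - n) = i by
      omega, show i + d - (max (n + d) n - (n + d)) = i + d by omega] at this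
  have hr := Nat.mod_lt i hd
  have hdm : 2 * d ≤ n + d := by omega
  have hstep : ∀ p, i % d + d * p + d = i % d + d * (p + 1) := fun p => by ring
  have hlt : ∀ p, p + 1 < (n + d - 1 - i % d) / d + 1 → i % d + d * p < n := fun p hp => by
    have := Nat.mul_le_mul_left d (Nat.lt_succ_iff.1 hp)
    have := Nat.mul_div_le (n + d - 1 - i % d) d
    have := hstep p
    omega
  have key := (isChainCodeword_of_chainCheck hdm hv hr).eq_zero_of_interference_above
    (Nat.succ_le_succ ((Nat.one_le_div_iff hd).2 (by omega)))
    (isChainCodeword_of_chainCheck hdm hw hr)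
    (fun p hp => hstep p ▸ h1 0 _ (hlt p hp)) (fun p hp => hstep p ▸ h1 1 _ (hlt p hp)) (i / d) (by
      rw [Nat.lt_succ_iff, Nat.le_div_iff_mul_le hd]
      have := Nat.div_add_mod' i d
      omega)
  simp only [Nat.mod_add_div] at key
  match a with
  | 0 => exact key.1
  | 1 => exact key.2

/-! ### The capacity -/

theorem mainTheorem7 (K n m : ℕ) (hK : 2 ≤ K) :
    ((m : ℝ) ≤ (n : ℝ) / 2 → IsSymCapacity K n m 0 ((n : ℝ) - (m : ℝ))) ∧
    ((n : ℝ) / 2 ≤ (m : ℝ) → (m : ℝ) ≤ 2 * (n : ℝ) / 3 → IsSymCapacity K n m 0 (m : ℝ)) ∧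
    (2 * (n : ℝ) / 3 ≤ (m : ℝ) → m < n → IsSymCapacity K n m 0 ((n : ℝ) - (m : ℝ) / 2)) ∧
    (m = n → IsSymCapacity K n m 0 ((n : ℝ) / (K : ℝ))) ∧
    (n < m → m ≤ 2 * n → IsSymCapacity K n m 0 ((m : ℝ) / 2)) ∧
    (2 * n ≤ m → IsSymCapacity K n m 0 (n : ℝ)) := by
  obtain ⟨K, rfl⟩ : ∃ k, K = k + 2 := ⟨K - 2, by omega⟩
  refine ⟨fun h => ?_, fun h1 h2 => ?_, fun h1 h2 => ?_, fun h => ?_, fun h1 h2 => ?_, fun h => ?_⟩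
  · -- only the top `n - m` levels are used; their interference arrives below all of them
    have hmn : 2 * m ≤ n := by
      have : (2 * m : ℝ) ≤ n := by linarith
      exact_mod_cast this
    have := isSymCapacity_of_levelChecks (K := K + 2) (n := n) (m := m) (s := 1) (r := m)
      (c := n - m) one_pos (by omega) (fun τ => level 0 (n - m + τ)) ?_ fun R hR =>
        hR.le_of_card_le (i := K + 1) rfl fun M T x G hG =>
          hG.card_le_side_information le_rfl (by omega)
    · rwa [Nat.cast_sub (by omega), Nat.cast_one, div_one] at this
    · intro v w hv hw h a i hi
      obtain rfl : a = 0 := Subsingleton.elim _ _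
      by_cases hid : i < n - m
      · have := h 0 i hi
        rwa [if_pos (by omega), if_neg (by omega), add_zero,
          show i - (max m n - n) = i by omega] at this
      · have := hv (i - (n - m)) (by omega)
        rwa [Nat.add_sub_cancel' (not_lt.1 hid)] at this
  · -- levels `n - m, …, 2 (n - m) - 1` stay empty: they collect the interference of the levels above
    -- them, and that of the levels below them is shifted out, as `n ≤ 3 (n - m)`
    have hmn : n ≤ 2 * m := by
      have : (n : ℝ) ≤ 2 * m := by linarith
      exact_mod_cast this
    have hmn' : 3 * m ≤ 2 * n := by
      have : (3 * m : ℝ) ≤ 2 * n := by linarith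
      exact_mod_cast this
    have := isSymCapacity_of_levelChecks (K := K + 2) (n := n) (m := m) (s := 1) (r := n - m)
      (c := m) one_pos (by omega) (fun τ => level 0 (n - m + τ)) ?_ fun R hR =>
        hR.le_of_card_le (i := K + 1) rfl fun M T x G hG => by
          have := hG.card_le_side_information (e := n - m) (by omega) (by omega)
          rwa [show n - (n - m) = m by omega] at this
    · rwa [Nat.cast_one, div_one] at this
    · intro v w hv hw h a i hi
      obtain rfl : a = 0 := Subsingleton.elim _ _
      have := h 0 i hi
      rw [if_pos (by omega), show i - (max m n - n) = i by omega] at this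
      by_cases hid : i < n - m
      · rwa [if_neg (by omega), add_zero] at this
      by_cases hid2 : i < 2 * (n - m)
      · have := hv (i - (n - m)) (by omega)
        rwa [Nat.add_sub_cancel' (not_lt.1 hid)] at this
      · have hw' := hw (i - 2 * (n - m)) (by omega)
        rwa [if_pos (by omega), show i - (max m n - m) = n - m + (i - 2 * (n - m)) by omega, hw',
          add_zero] at this
  · have hmn : 2 * n ≤ 3 * m := by
      have : (2 * n : ℝ) ≤ 3 * m := by linarith
      exact_mod_cast this
    have := isSymCapacity_of_levelChecks (K := K + 2) (n := n) (m := m) (s := 2) (r := m)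
      (c := 2 * max m n - m) two_pos (by omega) (fun τ => chainCheck (n - m) m τ)
      (fun v w hv hw h => eq_zero_of_chainCheck_of_lt h2 hmn hv hw h) fun R hR =>
        hR.le_of_card_le (i := K) rfl fun M T x G hG => hG.card_le_genie
    rw [max_eq_right h2.le, Nat.cast_sub (by omega)] at this
    convert this using 1
    push_cast
    ring
  · subst h
    -- time sharing: in slot `k` only transmitter `k` is active
    refine IsZeroErrorCode.isSymCapacity (s := K + 2) (by omega) (α := LevelVec (max m m))
      (by simp [ZMod.card])
      (f := fun k a t => if t = k then a else 0) ?_ fun R hR =>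
        hR.le_of_card_le (i := 0) (zero_add _) fun M T x G hG => by
          rw [pow_zero, one_mul]; exact hG.card_le_of_gains_eq
    intro k w w' h
    have := h k
    simp only [received] at this
    rw [Finset.sum_eq_zero fun j hj => by rw [if_neg (Finset.ne_of_mem_erase hj).symm,
      Matrix.mulVec_zero], Finset.sum_eq_zero fun j hj => by
      rw [if_neg (Finset.ne_of_mem_erase hj).symm, Matrix.mulVec_zero]] at this
    simpa using this
  · have := isSymCapacity_of_levelChecks (K := K + 2) (n := n) (m := m) (s := 2) (r := m)
      (c := 2 * max m n - m) two_pos (by omega) (fun τ => chainCheck (m - n) m τ)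
      (fun v w hv hw h => eq_zero_of_chainCheck_of_gt h1 h2 hv hw h) fun R hR =>
        hR.le_of_card_le (i := K) rfl fun M T x G hG => hG.card_le_genie
    rwa [max_eq_left h1.le, show 2 * m - m = m by omega] at this
  · -- only the top `n` levels are used; the signal arrives below all of the interference
    have := isSymCapacity_of_levelChecks (K := K + 2) (n := n) (m := m) (s := 1) (r := m - n)
      (c := n) one_pos (by omega) (fun τ => level 0 (n + τ)) ?_ fun R hR =>
        hR.le_of_card_le (i := K + 1) rfl fun M T x G hG => hG.card_le_direct
    · rwa [Nat.cast_one, div_one] at this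
    · intro v w hv hw h' a i hi
      obtain rfl : a = 0 := Subsingleton.elim _ _
      by_cases hin : i < n
      · have := h' 0 (i + (m - n)) (by omega)
        have hw' := hw (i + (m - n) - n) (by omega)
        rwa [if_pos (by omega), if_pos (by omega), show i + (m - n) - (max m n - n) = i by omega,
          show i + (m - n) - (max m n - m) = n + (i + (m - n) - n) by omega, hw', add_zero] at this
      · have := hv (i - n) (by omega)
        rwa [Nat.add_sub_cancel' (not_lt.1 hin)] at this
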